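/- Let $X$ be a complex vector space, $L(X)$ the algebra of all linear mappings $X\to X$, and let $A\subseteq L(X)$ be a (not necessarily unital) dense subalgebra in the sense of Jacobson: for all linearly independent $\xi_1,\dots,\xi_k\in X$ and all $\eta_1,\dots,\eta_k\in X$ there is $x\in A$ with $x\xi_i=\eta_i$ for all $i$. For $u_1,\dots,u_m,v_1,\dots,v_m\in L(X)$ write $\sum_{i=1}^m M_{u_i,v_i}$ for the linear mapping $A\to L(X)$, $x\mapsto\sum_{i=1}^m u_i x v_i$. Let $\phi=\sum_{i=1}^n M_{a_i,b_i}$ with $a_i,b_i\in L(X)$ have length $n$, i.e. $n$ is the least number of summands in any such representation of $\phi$. Put $$L(\phi)=\operatorname{span}\{a_1,\dots,a_n\},\qquad V(\phi)=\operatorname{span}\{b_ia_j:1\le i,j\le n\}.$$ For a finite-dimensional subspace $V\subseteq L(X)$ and $\zeta\in X$ let $V\zeta=\{T\zeta:T\in V\}$, and let $\operatorname{lDim}V=\max\{\dim V\zeta:\zeta\in X\}$. Suppose that $\operatorname{lDim}L(\phi)=n$, that $\operatorname{lDim}V(\phi)=1$, and that for every $\zeta\in X$ and every $x\in A$ with $xV(\phi)\zeta\subseteq\mathbb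 C\zeta$ the restriction $\phi(x)|_{L(\phi)\zeta}$ (which maps $L(\phi)\zeta$ into itself) is nilpotent. Then $$\dim V(\phi)\le\frac{n(n-1)}2 .$$ Moreover, if $\dim V(\phi)=\frac{n(n-1)}2$, then there are $u_1,\dots,u_n,v_1,\dots,v_n\in L(X)$ such that $\phi=\sum_{i=1}^n M_{u_i,v_i}$ and $v_iu_j=0$ for all $i\ge j$. -/

import Mathlib

namespace ElementaryOperators

variable {X Y : Type*} [AddCommGroup X] [Module ℂ X] [AddCommGroup Y] [Module ℂ Y]

/-- A (not necessarily unital) algebra `A` of linear mappings on `X` is dense in the sense of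
Jacobson: every finite linearly independent family can be sent to any prescribed family of the same
size by some member of `A`. -/
def IsDenseAlgebra (A : NonUnitalSubalgebra ℂ (Module.End ℂ X)) : Prop :=
  ∀ (k : ℕ) (ξ η : Fin k → X), LinearIndependent ℂ ξ → ∃ x ∈ A, ∀ i, x (ξ i) = η i

/-- The elementary operator `∑ i, M_{a i, b i} : A → L(X)`, `x ↦ ∑ i, a i * x * b i`. -/
def elementaryOperator (A : NonUnitalSubalgebra ℂ (Module.End ℂ X)) {n : ℕ}
    (a b : Fin n → Module.End ℂ X) : A →ₗ[ℂ] Module.End ℂ X where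
  toFun x := ∑ i, a i * (x : Module.End ℂ X) * b i
  map_add' x y := by simp [mul_add, add_mul, Finset.sum_add_distrib]
  map_smul' c x := by simp [Finset.smul_sum]

/-- The length of an elementary operator: the least number of summands in a representation. -/
noncomputable def length {A : NonUnitalSubalgebra ℂ (Module.End ℂ X)}
    (φ : A →ₗ[ℂ] Module.End ℂ X) : ℕ :=
  sInf {m : ℕ | ∃ u v : Fin m → Module.End ℂ X, φ = elementaryOperator A u v}

/-- `L(φ) = span {a_1, …, a_n}` for `φ = ∑ i, M_{a i, b i}`. -/
def spaceL {n : ℕ} (a : Fin n → Module.End ℂ X) : Submodule ℂ (Module.End ℂ X) :=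
  Submodule.span ℂ (Set.range a)

/-- `V(φ) = span {b_i a_j : 1 ≤ i, j ≤ n}` for `φ = ∑ i, M_{a i, b i}`. -/
def spaceV {n : ℕ} (a b : Fin n → Module.End ℂ X) : Submodule ℂ (Module.End ℂ X) :=
  Submodule.span ℂ (Set.range fun p : Fin n × Fin n => b p.1 * a p.2)

/-- The subspace `V ζ = {T ζ : T ∈ V}`. -/
def evalAt (V : Submodule ℂ (X →ₗ[ℂ] Y)) (ζ : X) : Submodule ℂ Y :=
  V.map (LinearMap.applyₗ ζ)

/-- The local dimension `max {dim V ζ : ζ ∈ X}` of a finite-dimensional space `V` of linear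
mappings. -/
noncomputable def lDim (V : Submodule ℂ (X →ₗ[ℂ] Y)) : ℕ :=
  ⨆ ζ : X, Module.finrank ℂ (evalAt V ζ)

/-- The supremum in `lDim` is a maximum when `V` is finite-dimensional. -/
theorem isGreatest_lDim (V : Submodule ℂ (X →ₗ[ℂ] Y)) [FiniteDimensional ℂ V] :
    IsGreatest (Set.range fun ζ : X => Module.finrank ℂ (evalAt V ζ)) (lDim V) := by
  have hb : BddAbove (Set.range fun ζ : X => Module.finrank ℂ (evalAt V ζ)) := by
    refine ⟨Module.finrank ℂ V, ?_⟩
    rintro _ ⟨ζ, rfl⟩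
    exact Submodule.finrank_map_le _ _
  exact ⟨Nat.sSup_mem ⟨_, 0, rfl⟩ hb, fun _ h => le_csSup hb h⟩

/-- The restriction `T|_W` is a nilpotent endomorphism of the (`T`-invariant) subspace `W`. -/
def IsNilpotentOn (T : Module.End ℂ X) (W : Submodule ℂ X) : Prop :=
  ∃ hW : ∀ w ∈ W, T w ∈ W, IsNilpotent (LinearMap.restrict T hW)

/-- The local nilpotency hypothesis for `φ = ∑ i, M_{a i, b i}` on `A`: whenever `ζ ∈ X` and `x ∈ A`
satisfy `x V(φ) ζ ⊆ ℂ ζ`, the restriction of `φ x` to `L(φ) ζ` is nilpotent. -/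
def LocallyNilpotent (A : NonUnitalSubalgebra ℂ (Module.End ℂ X)) {n : ℕ}
    (a b : Fin n → Module.End ℂ X) : Prop :=
  ∀ (ζ : X) (x : A), (evalAt (spaceV a b) ζ).map (x : Module.End ℂ X) ≤ Submodule.span ℂ {ζ} →
    IsNilpotentOn (elementaryOperator A a b x) (evalAt (spaceL a) ζ)

/-- The invariance of `L(φ) ζ` under `φ x` is automatic when `x V(φ) ζ ⊆ ℂ ζ`. -/
theorem invariant_evalAt (A : NonUnitalSubalgebra ℂ (Module.End ℂ X)) {n : ℕ}
    (a b : Fin n → Module.End ℂ X) (ζ : X) (x : A)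
    (hx : (evalAt (spaceV a b) ζ).map (x : Module.End ℂ X) ≤ Submodule.span ℂ {ζ}) :
    ∀ w ∈ evalAt (spaceL a) ζ, elementaryOperator A a b x w ∈ evalAt (spaceL a) ζ := by
  have ha : ∀ i, a i ζ ∈ evalAt (spaceL a) ζ := fun i =>
    ⟨a i, Submodule.subset_span ⟨i, rfl⟩, rfl⟩
  rintro _ ⟨T, hT, rfl⟩
  refine Submodule.span_induction (p := fun S _ => elementaryOperator A a b x
    (LinearMap.applyₗ ζ S) ∈ evalAt (spaceL a) ζ) ?_ (by simp) ?_ ?_ hT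
  · rintro _ ⟨j, rfl⟩
    have hs : elementaryOperator A a b x (LinearMap.applyₗ ζ (a j))
        = ∑ i, a i ((x : Module.End ℂ X) (b i (a j ζ))) := by
      simp [elementaryOperator]
    rw [hs]
    refine Submodule.sum_mem _ fun i _ => ?_
    have hm : (x : Module.End ℂ X) (b i (a j ζ)) ∈ Submodule.span ℂ {ζ} :=
      hx ⟨_, ⟨b i * a j, Submodule.subset_span ⟨(i, j), rfl⟩, rfl⟩, rfl⟩
    obtain ⟨c, hc⟩ := Submodule.mem_span_singleton.1 hm
    rw [← hc, map_smul]
    exact Submodule.smul_mem _ _ (ha i)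
  · intro S S' _ _ h h'
    simpa using Submodule.add_mem _ h h'
  · intro c S _ h
    simpa using Submodule.smul_mem _ c h

end ElementaryOperators

/-! For a functional `g` on `V(φ)` let `F g` be the matrix with entries `g (b i * a j)`. Since the
products `b i * a j` span `V(φ)`, the map `g ↦ F g` is injective, so the matrices `F g` form
a linear space of dimension `dim V(φ)`. This space consists of nilpotent matrices. If `g` is the
evaluation at a vector `ζ`, that is `T ζ = g T • y` for all `T` in `V(φ)`, and the vectors `a i ζ`
are linearly independent, density gives an `x` in `A` with `x y = ζ`, and `F g` is then the matrix
of the nilpotent restriction of `φ x` to `L(φ) ζ` (`isNilpotent_coeffMatrix_of_eval`). A space of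
local dimension one is spanned by one operator or has all ranges in a common line
(`eq_smul_or_range_le_line`); in either case all functionals are evaluations, up to scaling and a
limit (`isNilpotent_coeffMatrix`).

The result is therefore Gerstenhaber's theorem: a linear space of nilpotent `n × n` matrices has
dimension at most `n (n - 1) / 2` (`finrank_le_choose`), and with equality it is conjugate to the
strictly upper triangular matrices (`exists_basis_strictly_triangular`). Conjugating the matrices
`F g` amounts to changing the representation of `φ` (`elementaryOperator_changeBasis`), and then
`g (v i * u j) = 0` for all `g` and `j ≤ i`.

Gerstenhaber's theorem is proved over a field, of characteristic zero for the equality case. The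
inequality is an induction over the compression to a hyperplane along an adapted vector `x`, one
for which `V` has no rank-one operator with range the line of `x` (`exists_adapted`). In the
equality case the induction supplies many elements of `V` of the form `L ⊗ y + c ⊗ x`, where
`L ⊗ y` denotes `v ↦ L v • y`. Since symmetrized products of elements of `V` have trace zero,
these operators have rank at most one and share their range, which turns out to be spanned by a
common kernel vector of `V` (`exists_forall_apply_eq_zero`).
-/

/-! ### Linear spaces of nilpotent operators: adapted vectors -/

namespace NilpotentSpace

universe u

variable {K : Type*} {E : Type u} [Field K] [AddCommGroup E] [Module K E]

/-- A space of nilpotent operators has an adapted vector: some `x ≠ 0` such that no rank-one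
operator in `V` has range the line of `x`. Otherwise each vector `e i` of a basis carries a
rank-one operator `v ↦ L i v • e i` in `V`. On a minimal set `C` of indices closed under "some
`L i (e j)` is nonzero", the functionals pair with the basis vectors like a permutation, so the sum
of these operators over `C` maps the span of `e '' C` onto itself and is not nilpotent. -/
theorem exists_adapted [FiniteDimensional K E] [Nontrivial E]
    {V : Submodule K (Module.End K E)} (hV : ∀ A ∈ V, IsNilpotent A) :
    ∃ x : E, x ≠ 0 ∧ ∀ L : Module.Dual K E, L.smulRight x ∈ V → L = 0 := by
  classical
  by_contra! h
  let e := Module.finBasis K E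
  have : Nonempty (Fin (Module.finrank K E)) := e.index_nonempty
  choose L hLV hL0 using fun i => h (e i) (e.ne_zero i)
  obtain ⟨C, ⟨hCne, hC⟩, hmin⟩ := exists_minimal_of_wellFoundedLT
    (fun C : Finset (Fin (Module.finrank K E)) =>
      C.Nonempty ∧ ∀ i ∈ C, ∃ j ∈ C, L i (e j) ≠ 0)
    ⟨Finset.univ, Finset.univ_nonempty, fun i _ => by
      by_contra! hi
      exact hL0 i (e.ext fun j => by simpa using hi j (Finset.mem_univ j))⟩
  have hinj : ∀ t : Fin (Module.finrank K E) → Fin (Module.finrank K E),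
      (∀ i ∈ C, t i ∈ C) → (∀ i ∈ C, L i (e (t i)) ≠ 0) →
        C.image t = C ∧ Set.InjOn t C := by
    intro t htC ht
    have hle : C.image t ⊆ C := Finset.image_subset_iff.2 htC
    have heq : C.image t = C := by
      refine le_antisymm hle (hmin ⟨hCne.image t, ?_⟩ hle)
      intro i hi
      exact ⟨t i, Finset.mem_image_of_mem t (hle hi), ht i (hle hi)⟩
    exact ⟨heq, Finset.card_image_iff.1 (congrArg Finset.card heq)⟩
  choose! s hsC hs using hC
  obtain ⟨hsim, hsinj⟩ := hinj s hsC hs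
  -- A second `j` would allow a choice function that differs from `s` only at `i`,
  -- which is then not injective.
  have huniq : ∀ i ∈ C, ∀ j ∈ C, j ≠ s i → L i (e j) = 0 := by
    intro i hi j hj hji
    by_contra hne
    obtain ⟨i', hi', rfl⟩ := Finset.mem_image.1 (hsim.symm ▸ hj : j ∈ C.image s)
    have hii' : i' ≠ i := fun h => hji (by rw [h])
    refine hii' ((hinj (Function.update s i (s i')) ?_ ?_).2 hi' hi ?_)
    · intro k hk
      by_cases hki : k = i
      · subst hki; simpa using hj
      · simpa [hki] using hsC k hk
    · intro k hk
      by_cases hki : k = i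
      · subst hki; simpa using hne
      · simpa [hki] using hs k hk
    · simp [hii']
  set B : Module.End K E := ∑ i ∈ C, (L i).smulRight (e i) with hB
  obtain ⟨k, hk⟩ := hV B (V.sum_mem fun i _ => hLV i)
  set S := Submodule.span K (e '' C) with hS
  have heS : ∀ i ∈ C, e i ∈ S := fun i hi => Submodule.subset_span ⟨i, hi, rfl⟩
  have hSB : S ≤ S.map B := by
    refine Submodule.span_le.2 ?_
    rintro _ ⟨i, hi, rfl⟩
    refine ⟨(L i (e (s i)))⁻¹ • e (s i), S.smul_mem _ (heS _ (hsC i hi)), ?_⟩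
    have : B (e (s i)) = L i (e (s i)) • e i := by
      rw [hB, LinearMap.sum_apply, Finset.sum_eq_single_of_mem i hi]
      · simp
      · intro k hk hki
        have := huniq k hk (s i) (hsC i hi) fun h => hki (hsinj hk hi h.symm)
        simp [this]
    rw [map_smul, this, inv_smul_smul₀ (hs i hi)]
  have hpow : ∀ m : ℕ, S ≤ S.map (B ^ m) := by
    intro m
    induction m with
    | zero => simp [Module.End.one_eq_id]
    | succ m ih =>
      rw [pow_succ', Module.End.mul_eq_comp, Submodule.map_comp]
      exact hSB.trans (Submodule.map_mono ih)
  obtain ⟨i, hi⟩ := hCne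
  have := hpow k (heS i hi)
  rw [hk, Submodule.map_zero] at this
  exact e.ne_zero i (by simpa using this)

/-! ### Compression to a hyperplane -/

/-- The projection of `E` onto the hyperplane `ker f` along a vector `x` with `f x = 1`. -/
def kerProj (f : Module.Dual K E) (x : E) (hfx : f x = 1) : E →ₗ[K] LinearMap.ker f :=
  (LinearMap.id - f.smulRight x).codRestrict (LinearMap.ker f) (by simp [hfx])

theorem coe_kerProj (f : Module.Dual K E) (x : E) (hfx : f x = 1) (v : E) :
    (kerProj f x hfx v : E) = v - f v • x := rfl

theorem kerProj_coe (f : Module.Dual K E) (x : E) (hfx : f x = 1) (h : LinearMap.ker f) :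
    kerProj f x hfx h = h := by
  ext
  have : f h = 0 := h.2
  simp [coe_kerProj, this]

/-- The compression `A ↦ π A ι` of an endomorphism of `E` to the hyperplane `ker f`, where `ι` is
the inclusion of `ker f` and `π` the projection along `x`. It stands for the endomorphism that `A`
induces on the quotient of `E` by the line through `x` whenever `A x = 0`. -/
def compress (f : Module.Dual K E) (x : E) (hfx : f x = 1) :
    Module.End K E →ₗ[K] Module.End K (LinearMap.ker f) where
  toFun A := kerProj f x hfx ∘ₗ A ∘ₗ (LinearMap.ker f).subtype
  map_add' A B := by ext; simp
  map_smul' c A := by ext; simp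

theorem compress_kerProj {f : Module.Dual K E} {x : E} (hfx : f x = 1) {A : Module.End K E}
    (hA : A x = 0) (v : E) :
    compress f x hfx A (kerProj f x hfx v) = kerProj f x hfx (A v) := by
  simp [compress, coe_kerProj, hA]

theorem isNilpotent_compress {f : Module.Dual K E} {x : E} (hfx : f x = 1) {A : Module.End K E}
    (hA : A x = 0) (hn : IsNilpotent A) : IsNilpotent (compress f x hfx A) := by
  obtain ⟨k, hk⟩ := hn
  have h : ∀ (m : ℕ) (v : E),
      (compress f x hfx A ^ m) (kerProj f x hfx v) = kerProj f x hfx ((A ^ m) v) := by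
    intro m
    induction m with
    | zero => simp
    | succ m ih =>
      intro v
      rw [pow_succ, Module.End.mul_apply, compress_kerProj hfx hA, ih, pow_succ,
        Module.End.mul_apply]
  refine ⟨k, LinearMap.ext fun v => ?_⟩
  rw [← kerProj_coe f x hfx v, h, hk]
  simp

/-- An operator that annihilates `x` is determined by its compression together with the functional
`f ∘ A`, its component along `x`. -/
theorem apply_eq_of_apply_eq_zero {f : Module.Dual K E} {x : E} (hfx : f x = 1)
    {A : Module.End K E} (hA : A x = 0) (v : E) :
    A v = f (A v) • x + (compress f x hfx A (kerProj f x hfx v) : E) := by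
  rw [compress_kerProj hfx hA, coe_kerProj]
  abel

/-- The members of `V` that annihilate the vector `x`. -/
def annihilating (V : Submodule K (Module.End K E)) (x : E) : Submodule K (Module.End K E) :=
  V ⊓ LinearMap.ker (LinearMap.applyₗ x)

/-- The functionals `L` such that the operator `v ↦ L v • x` belongs to `V`. -/
def rankOneFunctionals (V : Submodule K (Module.End K E)) (x : E) :
    Submodule K (Module.Dual K E) :=
  V.comap (LinearMap.smulRightₗ.flip x)

theorem mem_rankOneFunctionals {V : Submodule K (Module.End K E)} {x : E}
    {L : Module.Dual K E} : L ∈ rankOneFunctionals V x ↔ L.smulRight x ∈ V := Iff.rfl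

theorem finrank_map_add_finrank_inf_ker {M N : Type*} [AddCommGroup M] [Module K M]
    [AddCommGroup N] [Module K N] (S : Submodule K M) [FiniteDimensional K S] (g : M →ₗ[K] N) :
    Module.finrank K (S.map g) + Module.finrank K (S ⊓ LinearMap.ker g : Submodule K M)
      = Module.finrank K S := by
  have h := (g.domRestrict S).finrank_range_add_finrank_ker
  rw [LinearMap.range_domRestrict, LinearMap.ker_domRestrict] at h
  rw [← h, ← Submodule.map_comap_subtype,
    (Submodule.equivMapOfInjective _ S.subtype_injective _).symm.finrank_eq]

variable {V : Submodule K (Module.End K E)}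

theorem notMem_map_apply (hV : ∀ A ∈ V, IsNilpotent A) {x : E} (hx : x ≠ 0) :
    x ∉ V.map (LinearMap.applyₗ x) := by
  rintro ⟨A, hA, hAx⟩
  have hAx : A x = x := hAx
  obtain ⟨k, hk⟩ := hV A hA
  have : ∀ m : ℕ, (A ^ m) x = x := by
    intro m
    induction m with
    | zero => simp
    | succ m ih => rw [pow_succ, Module.End.mul_apply, hAx, ih]
  exact hx (by rw [← this k, hk]; rfl)

theorem isNilpotent_of_mem_map_compress (hV : ∀ A ∈ V, IsNilpotent A) {f : Module.Dual K E} {x : E}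
    (hfx : f x = 1) : ∀ A ∈ (annihilating V x).map (compress f x hfx), IsNilpotent A := by
  rintro _ ⟨A, ⟨hA, hAx⟩, rfl⟩
  exact isNilpotent_compress hfx hAx (hV A hA)

/-! ### Rank-one operators along an adapted vector -/

/-- For an adapted `x`, the scalar `t` with `L ⊗ (y + t x)` in `V` does not depend on `L`. -/
theorem exists_forall_rankOne_mem {x y : E}
    (hx : ∀ L : Module.Dual K E, L.smulRight x ∈ V → L = 0)
    (h : ∀ L : Module.Dual K E, L x = 0 → L y = 0 → ∃ t : K, L.smulRight (y + t • x) ∈ V) :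
    ∃ t : K, ∀ L : Module.Dual K E, L x = 0 → L y = 0 → L.smulRight (y + t • x) ∈ V := by
  by_cases hall : ∀ L : Module.Dual K E, L x = 0 → L y = 0 → L = 0
  · exact ⟨0, fun L hLx hLy => by simp [hall L hLx hLy]⟩
  push Not at hall
  obtain ⟨L₀, h₀x, h₀y, h₀⟩ := hall
  obtain ⟨t₀, ht₀⟩ := h L₀ h₀x h₀y
  refine ⟨t₀, fun L hLx hLy => ?_⟩
  obtain ⟨t, ht⟩ := h L hLx hLy
  obtain ⟨s, hs⟩ := h (L + L₀) (by simp [hLx, h₀x]) (by simp [hLy, h₀y])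
  -- Comparing the scalars of `L`, `L₀` and `L + L₀` leaves an operator with range in the
  -- line of `x`.
  have key : (s - t) • L + (s - t₀) • L₀ = 0 := by
    refine hx _ ?_
    convert V.sub_mem (V.sub_mem hs ht) ht₀ using 1
    ext v
    simp only [LinearMap.smulRight_apply, LinearMap.add_apply, LinearMap.sub_apply,
      LinearMap.smul_apply, smul_eq_mul]
    module
  by_cases hst : s = t
  · subst hst
    have : s = t₀ := by simpa [h₀, sub_eq_zero] using key
    exact this ▸ ht
  · have hL : L = (-(s - t₀) / (s - t)) • L₀ := by
      have hst := sub_ne_zero.2 hst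
      have : (s - t) • L = (-(s - t₀)) • L₀ := by
        rw [neg_smul (s - t₀) L₀]; exact eq_neg_of_add_eq_zero_left key
      rw [div_eq_inv_mul, mul_smul, ← this, inv_smul_smul₀ hst]
    rw [hL]
    convert V.smul_mem (-(s - t₀) / (s - t)) ht₀ using 1
    ext v
    simp [mul_smul]

/-! ### Trace identities -/

theorem trace_pow_eq_zero (hV : ∀ A ∈ V, IsNilpotent A) {A : Module.End K E} (hA : A ∈ V)
    {k : ℕ} (hk : k ≠ 0) : LinearMap.trace K E (A ^ k) = 0 :=
  (LinearMap.isNilpotent_trace_of_isNilpotent ((hV A hA).pow_of_pos hk)).eq_zero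

section CharZero

variable [CharZero K]

theorem trace_mul_eq_zero (hV : ∀ A ∈ V, IsNilpotent A) {A B : Module.End K E} (hA : A ∈ V)
    (hB : B ∈ V) : LinearMap.trace K E (A * B) = 0 := by
  have h := trace_pow_eq_zero hV (V.add_mem hA hB) two_ne_zero
  have h1 := trace_pow_eq_zero hV hA two_ne_zero
  have h2 := trace_pow_eq_zero hV hB two_ne_zero
  rw [show (A + B) ^ 2 = A ^ 2 + B ^ 2 + (A * B + B * A) by noncomm_ring] at h
  rw [map_add, map_add, map_add, h1, h2, LinearMap.trace_mul_comm K B A] at h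
  have : (2 : K) * LinearMap.trace K E (A * B) = 0 := by linear_combination h
  simpa using this

/-- The part of `tr ((B ± A) ^ 3) = 0` that is quadratic in `A`. -/
theorem trace_mul_mul_eq_zero (hV : ∀ A ∈ V, IsNilpotent A) {A B : Module.End K E} (hA : A ∈ V)
    (hB : B ∈ V) : LinearMap.trace K E (A * A * B) = 0 := by
  have h := trace_pow_eq_zero hV (V.add_mem hB hA) three_ne_zero
  have h' := trace_pow_eq_zero hV (V.sub_mem hB hA) three_ne_zero
  have h1 := trace_pow_eq_zero hV hB three_ne_zero
  have e : (B + A) ^ 3 + (B - A) ^ 3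
      = 2 • (B ^ 3) + 2 • (A * A * B + A * B * A + B * A * A) := by noncomm_ring
  have e' := congrArg (LinearMap.trace K E) e
  rw [map_add, h, h', map_add, map_nsmul, map_nsmul, h1, map_add, map_add,
    LinearMap.trace_mul_cycle K A B A, mul_assoc B A A, LinearMap.trace_mul_comm K B (A * A)] at e'
  have : (6 : K) * LinearMap.trace K E (A * A * B) = 0 := by
    simp only [nsmul_eq_mul, Nat.cast_ofNat] at e'
    linear_combination -e'
  simpa using this

/-- The part of `tr ((B ± A) ^ 4) = 0` that is quadratic in `A`, when `A` squares to zero. -/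
theorem trace_mul_mul_mul_eq_zero (hV : ∀ A ∈ V, IsNilpotent A) {A B : Module.End K E}
    (hA : A ∈ V) (hB : B ∈ V) (hA2 : A * A = 0) :
    LinearMap.trace K E ((A * B) * (A * B)) = 0 := by
  have h := trace_pow_eq_zero hV (V.add_mem hB hA) four_ne_zero
  have h' := trace_pow_eq_zero hV (V.sub_mem hB hA) four_ne_zero
  have h1 := trace_pow_eq_zero hV hB four_ne_zero
  have e : (B + A) ^ 4 + (B - A) ^ 4
      = 2 • (B ^ 4) + 2 • ((A * B) * (A * B) + (B * A) * (B * A) + (A * A) * B * B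
        + B * (A * A) * B + B * B * (A * A) + A * (B * B) * A + (A * A) * (A * A)) := by
    noncomm_ring
  rw [hA2] at e
  simp only [zero_mul, mul_zero, add_zero] at e
  have e' := congrArg (LinearMap.trace K E) e
  have c1 : LinearMap.trace K E (A * (B * B) * A) = 0 := by
    rw [LinearMap.trace_mul_comm, ← mul_assoc, hA2, zero_mul, map_zero]
  have c2 : LinearMap.trace K E ((B * A) * (B * A)) = LinearMap.trace K E ((A * B) * (A * B)) := by
    rw [mul_assoc, LinearMap.trace_mul_comm]
    simp only [mul_assoc]
  rw [map_add, h, h', map_add, map_nsmul, map_nsmul, h1, map_add, map_add, c1, c2] at e'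
  have : (4 : K) * LinearMap.trace K E ((A * B) * (A * B)) = 0 := by
    simp only [nsmul_eq_mul, Nat.cast_ofNat] at e'
    linear_combination -e'
  simpa using this

end CharZero

/-! ### The dimension bound -/

variable [FiniteDimensional K E]

theorem rankOne_apply_self (hV : ∀ A ∈ V, IsNilpotent A) {x : E} {L : Module.Dual K E}
    (hL : L.smulRight x ∈ V) : L x = 0 := by
  rw [← LinearMap.trace_smulRight (R := K) L x]
  exact (LinearMap.isNilpotent_trace_of_isNilpotent (hV _ hL)).eq_zero

/-- The dimension of `V` splits into the orbit `V x`, the compression of the annihilator of `x`,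
and the rank-one operators in `V` with range the line of `x`; the last are the kernel of the
compression on that annihilator. -/
theorem finrank_eq_finrank_map_add (hV : ∀ A ∈ V, IsNilpotent A) {f : Module.Dual K E} {x : E}
    (hfx : f x = 1) :
    Module.finrank K V = Module.finrank K (V.map (LinearMap.applyₗ x)) +
      (Module.finrank K ((annihilating V x).map (compress f x hfx)) +
        Module.finrank K (rankOneFunctionals V x)) := by
  have hx : x ≠ 0 := by rintro rfl; simp at hfx
  rw [← finrank_map_add_finrank_inf_ker V (LinearMap.applyₗ x),
    ← finrank_map_add_finrank_inf_ker (V ⊓ _) (compress f x hfx)]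
  have hinj : Function.Injective (LinearMap.smulRightₗ.flip x : Module.Dual K E →ₗ[K] _) := by
    rw [injective_iff_map_eq_zero]
    intro L hL
    ext v
    simpa [hx] using LinearMap.congr_fun hL v
  have : (rankOneFunctionals V x).map (LinearMap.smulRightₗ.flip x)
      = (V ⊓ LinearMap.ker (LinearMap.applyₗ x)) ⊓ LinearMap.ker (compress f x hfx) := by
    ext A
    constructor
    · rintro ⟨L, hL, rfl⟩
      refine ⟨⟨hL, ?_⟩, ?_⟩
      · have := rankOne_apply_self hV (mem_rankOneFunctionals.1 hL)
        simp [this]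
      · refine LinearMap.mem_ker.2 (LinearMap.ext fun h => Subtype.ext ?_)
        simp [compress, coe_kerProj, hfx]
    · rintro ⟨⟨hA, hAx⟩, hAc⟩
      have : A = (f ∘ₗ A).smulRight x := by
        ext v
        rw [apply_eq_of_apply_eq_zero hfx hAx v, LinearMap.mem_ker.1 hAc]
        simp
      exact ⟨f ∘ₗ A, by rw [SetLike.mem_coe, mem_rankOneFunctionals, ← this]; exact hA, this.symm⟩
  rw [← this, (Submodule.equivMapOfInjective _ hinj _).symm.finrank_eq]
  rfl

theorem finrank_ker_of_apply_eq_one {n : ℕ} (hn : Module.finrank K E = n + 1)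
    {f : Module.Dual K E} {x : E} (hfx : f x = 1) :
    Module.finrank K (LinearMap.ker f) = n := by
  have := Module.Dual.finrank_ker_add_one_of_ne_zero (f := f) (by rintro rfl; simp at hfx)
  omega

/-- Gerstenhaber's inequality: a space of nilpotent operators on a space of dimension `n` has
dimension at most `n (n - 1) / 2`. For an adapted `x` the last summand in
`finrank_eq_finrank_map_add` vanishes, and `V x` is a proper subspace because it misses `x`. -/
theorem finrank_le_choose {K : Type*} [Field K] (n : ℕ) : ∀ {E : Type u} [AddCommGroup E]
    [Module K E] [FiniteDimensional K E] (_ : Module.finrank K E = n)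
    {V : Submodule K (Module.End K E)} (_ : ∀ A ∈ V, IsNilpotent A),
    Module.finrank K V ≤ n.choose 2 := by
  induction n with
  | zero =>
    intro E _ _ _ hn V hV
    have := Module.finrank_zero_iff.1 hn
    have : Subsingleton V := inferInstance
    simp [Module.finrank_zero_of_subsingleton (R := K) (M := V)]
  | succ n ih =>
    intro E _ _ _ hn V hV
    have : Nontrivial E := Module.nontrivial_of_finrank_pos (R := K) (by omega)
    obtain ⟨x, hx, hadapted⟩ := exists_adapted hV
    obtain ⟨f, hfx⟩ := Module.Projective.exists_dual_eq_one K hx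
    have hR : rankOneFunctionals V x = ⊥ := (Submodule.eq_bot_iff _).2 hadapted
    have hlt := Submodule.finrank_lt (s := V.map (LinearMap.applyₗ x))
      fun h => notMem_map_apply hV hx (h ▸ Submodule.mem_top)
    have hc := ih (finrank_ker_of_apply_eq_one hn hfx) (isNilpotent_of_mem_map_compress hV hfx)
    rw [finrank_eq_finrank_map_add hV hfx, hR, finrank_bot, Nat.choose_succ_succ n 1,
      Nat.choose_one_right]
    simp only [Nat.succ_eq_add_one, Nat.reduceAdd]
    omega

/-- If a space of maximal dimension has a common kernel vector `z`, its compression along `z` is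
again of maximal dimension, and it contains every nilpotent rank-one operator with range the line of
`z`: both are forced by comparing dimensions. -/
theorem finrank_compress_eq_and_rankOne_mem (hV : ∀ A ∈ V, IsNilpotent A) {n : ℕ}
    (hn : Module.finrank K E = n + 1)
    (hmax : Module.finrank K V = (n + 1).choose 2) {f : Module.Dual K E} {z : E} (hfz : f z = 1)
    (hz : ∀ A ∈ V, A z = 0) :
    Module.finrank K ((annihilating V z).map (compress f z hfz)) = n.choose 2 ∧
      ∀ L : Module.Dual K E, L z = 0 → L.smulRight z ∈ V := by
  have hz0 : z ≠ 0 := by rintro rfl; simp at hfz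
  have hVz : V.map (LinearMap.applyₗ z) = ⊥ := by
    refine (Submodule.eq_bot_iff _).2 ?_
    rintro _ ⟨A, hA, rfl⟩
    exact hz A hA
  have hle : rankOneFunctionals V z ≤ LinearMap.ker (Module.Dual.eval K E z) :=
    fun L hL => rankOne_apply_self hV hL
  have hker : Module.finrank K (LinearMap.ker (Module.Dual.eval K E z)) = n := by
    have := Module.Dual.finrank_ker_add_one_of_ne_zero (f := Module.Dual.eval K E z)
      ((Module.eval_apply_eq_zero_iff K z).not.2 hz0)
    rw [Subspace.dual_finrank_eq] at this
    omega
  have hR := Submodule.finrank_mono hle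
  have hc := finrank_le_choose n (finrank_ker_of_apply_eq_one hn hfz)
    (isNilpotent_of_mem_map_compress hV hfz)
  rw [finrank_eq_finrank_map_add hV hfz, hVz, finrank_bot, Nat.choose_succ_succ n 1,
    Nat.choose_one_right] at hmax
  simp only [Nat.succ_eq_add_one, Nat.reduceAdd] at hmax
  refine ⟨by omega, fun L hL => ?_⟩
  have : rankOneFunctionals V z = LinearMap.ker (Module.Dual.eval K E z) :=
    Submodule.eq_of_le_of_finrank_eq hle (by omega)
  exact mem_rankOneFunctionals.1 (this ▸ hL)

/-! ### Spaces of maximal dimension -/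

theorem trace_rankOne_mul (L : Module.Dual K E) (y : E) (M : Module.End K E) :
    LinearMap.trace K E (L.smulRight y * M) = L (M y) := by
  rw [show L.smulRight y * M = (L ∘ₗ M).smulRight y from rfl, LinearMap.trace_smulRight]
  rfl

variable [CharZero K]

/-- Let `V x` and `x` span `E`, and let `T = L ⊗ y + c ⊗ x` belong to `V`, where `L` annihilates `x`
and `y`. If `L ≠ 0` then `c` is a multiple of `L`, so that `T = L ⊗ (y + t x)` for some `t`. The
trace identities give first `T ^ 2 = 0`, then `L (M y) = - c (M x)` and
`L (M y) ^ 2 + L (M x) * c (M y) = 0` for `M` in `V`; hence `c` vanishes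
wherever `L` does. -/
theorem exists_rankOne_mem_of_add_mem (hV : ∀ A ∈ V, IsNilpotent A) {x y : E}
    (hspan : ∀ v, ∃ M ∈ V, ∃ α : K, v = M x + α • x)
    {L c : Module.Dual K E} (hLx : L x = 0) (hLy : L y = 0) (hcx : c x = 0)
    (hT : L.smulRight y + c.smulRight x ∈ V) :
    ∃ t : K, L.smulRight (y + t • x) ∈ V := by
  by_cases hL0 : L = 0
  · exact ⟨0, by simp [hL0]⟩
  have hcy : c y = 0 := by
    by_contra hcy
    refine hL0 (LinearMap.ext fun v => ?_)
    obtain ⟨M, hM, α, rfl⟩ := hspan v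
    have h := trace_mul_mul_eq_zero hV hT hM
    have e : (L.smulRight y + c.smulRight x) * (L.smulRight y + c.smulRight x)
        = c y • L.smulRight x := by
      ext v
      simp [hLx, hLy, hcx, smul_smul, mul_comm]
    rw [e, smul_mul_assoc, map_smul, trace_rankOne_mul, smul_eq_mul] at h
    simp [(mul_eq_zero.1 h).resolve_left hcy, hLx]
  -- Now `T ^ 2 = 0`, which makes the fourth-order identity available.
  have hsq : (L.smulRight y + c.smulRight x) * (L.smulRight y + c.smulRight x) = 0 := by
    ext v
    simp [hLx, hLy, hcx, hcy]
  have h1 : ∀ M ∈ V, L (M y) + c (M x) = 0 := by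
    intro M hM
    have h := trace_mul_eq_zero hV hT hM
    rwa [add_mul, map_add, trace_rankOne_mul, trace_rankOne_mul] at h
  have h2 : ∀ M ∈ V, L (M x) = 0 → c (M x) = 0 := by
    intro M hM hLM
    have h := trace_mul_mul_mul_eq_zero hV hT hM hsq
    rw [add_mul, mul_add, add_mul, add_mul, map_add, map_add, map_add] at h
    simp only [mul_assoc, trace_rankOne_mul] at h
    simp only [Module.End.mul_apply, LinearMap.smulRight_apply, map_smul, hLM, smul_eq_mul] at h
    have := h1 M hM
    have h3 : 2 * c (M x) ^ 2 = 0 := by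
      rw [eq_neg_of_add_eq_zero_left this] at h
      linear_combination h
    simpa using h3
  have hker : ∀ v, L v = 0 → c v = 0 := by
    intro v hv
    obtain ⟨M, hM, α, rfl⟩ := hspan v
    have hLM : L (M x) = 0 := by simpa [hLx] using hv
    simp [h2 M hM hLM, hcx]
  obtain ⟨w, hw⟩ : ∃ w, L w ≠ 0 := by
    by_contra! h
    exact hL0 (LinearMap.ext h)
  refine ⟨c w / L w, ?_⟩
  convert hT using 1
  ext v
  have h := hker (v - (L v / L w) • w) (by simp [hw])
  have h : c v = L v / L w * c w := by simpa [sub_eq_zero] using h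
  simp only [LinearMap.smulRight_apply, LinearMap.add_apply, smul_add, h, smul_smul]
  congr 2
  ring

/-- If `V` contains `L ⊗ z` for every `L` that annihilates `x` and `z`, while `V x` and `x` span
`E`, then `z` is a common kernel vector. The identities `L (N z) = 0` and `L (N (N z)) = 0` put
`V z` into the span of `x` and `z`; if `V z` were nonzero, polarizing the second would put `V x`
there too, which is impossible in dimension at least three. -/
theorem apply_eq_zero_of_forall_rankOne_mem (hV : ∀ A ∈ V, IsNilpotent A) {x z : E}
    (hz : ∀ L : Module.Dual K E, L x = 0 → L z = 0 → L.smulRight z ∈ V)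
    (hspan : ∀ v, ∃ M ∈ V, ∃ α : K, v = M x + α • x) (hn : 2 < Module.finrank K E) :
    ∀ A ∈ V, A z = 0 := by
  have hmem : ∀ v : E, (∀ L : Module.Dual K E, L x = 0 → L z = 0 → L v = 0) →
      v ∈ Submodule.span K {x, z} := by
    intro v hv
    by_contra hvP
    obtain ⟨L, hLv, hL⟩ := Submodule.exists_le_ker_of_notMem hvP
    exact hLv (hv L (hL (Submodule.subset_span (by simp))) (hL (Submodule.subset_span (by simp))))
  have hLz : ∀ L : Module.Dual K E, L x = 0 → L z = 0 → ∀ N ∈ V, L (N z) = 0 := by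
    intro L hLx hLz N hN
    rw [← trace_rankOne_mul]
    exact trace_mul_eq_zero hV (hz L hLx hLz) hN
  have hLzz : ∀ L : Module.Dual K E, L x = 0 → L z = 0 → ∀ N ∈ V, L (N (N z)) = 0 := by
    intro L hLx hLz N hN
    have := trace_mul_mul_eq_zero hV hN (hz L hLx hLz)
    rw [LinearMap.trace_mul_comm, trace_rankOne_mul] at this
    simpa using this
  intro M hM
  by_contra hMz
  obtain ⟨α, β, hαβ⟩ := Submodule.mem_span_pair.1
    (hmem (M z) fun L hLx hLz' => hLz L hLx hLz' M hM)
  -- Otherwise `z` would be an eigenvector of `M` for a nonzero eigenvalue.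
  have hα : α ≠ 0 := by
    rintro rfl
    have hβ : β ≠ 0 := by rintro rfl; simp at hαβ; exact hMz hαβ.symm
    refine notMem_map_apply hV (x := z) (by rintro rfl; simp at hMz)
      ⟨β⁻¹ • M, V.smul_mem _ hM, ?_⟩
    simp [← hαβ, hβ]
  have hMx : ∀ L : Module.Dual K E, L x = 0 → L z = 0 → L (M x) = 0 := by
    intro L hLx hLz'
    have := hLzz L hLx hLz' M hM
    rw [← hαβ, map_add, map_smul, map_smul, map_add, map_smul, map_smul,
      hLz L hLx hLz' M hM] at this
    simpa [hα] using this
  have hNx : ∀ N ∈ V, ∀ L : Module.Dual K E, L x = 0 → L z = 0 → L (N x) = 0 := by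
    intro N hN L hLx hLz'
    obtain ⟨γ, δ, hγδ⟩ := Submodule.mem_span_pair.1
      (hmem (N z) fun L hLx hLz' => hLz L hLx hLz' N hN)
    have h := hLzz L hLx hLz' (M + N) (V.add_mem hM hN)
    have h1 := hLzz L hLx hLz' M hM
    have h2 := hLzz L hLx hLz' N hN
    have h3 : L (M (N z)) = 0 := by
      rw [← hγδ]; simp [hMx L hLx hLz', hLz L hLx hLz' M hM]
    have h4 : L (N (M z)) = 0 := by
      simpa [h1, h2, h3] using h
    rw [← hαβ] at h4
    simpa [hLz L hLx hLz' N hN, hα] using h4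
  have htop : (⊤ : Submodule K E) ≤ Submodule.span K {x, z} := by
    intro v _
    refine hmem v fun L hLx hLz' => ?_
    obtain ⟨N, hN, α, rfl⟩ := hspan v
    simp [hNx N hN L hLx hLz', hLx]
  classical
  have hle := finrank_span_finset_le_card (R := K) ({x, z} : Finset E)
  have hc := Finset.card_le_two (a := x) (b := z)
  rw [Set.finrank, Finset.coe_pair, top_le_iff.1 htop, finrank_top] at hle
  omega

/-- A space of nilpotent operators of maximal dimension on a nonzero space has a common kernel
vector. The compression along an adapted vector `x` is again of maximal dimension, so by induction
it has a common kernel vector `y` and contains all nilpotent rank-one operators with range the line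
of `y`; lifting these to `V` produces the common kernel vector `y + t x`. -/
theorem exists_forall_apply_eq_zero (n : ℕ) : ∀ {E : Type u} [AddCommGroup E]
    [Module K E] [FiniteDimensional K E] (_ : Module.finrank K E = n + 1)
    {V : Submodule K (Module.End K E)} (_ : ∀ A ∈ V, IsNilpotent A)
    (_ : Module.finrank K V = (n + 1).choose 2), ∃ z : E, z ≠ 0 ∧ ∀ A ∈ V, A z = 0 := by
  induction n with
  | zero =>
    intro E _ _ _ hn V hV hmax
    have : Nontrivial E := Module.nontrivial_of_finrank_pos (R := K) (by omega)
    obtain ⟨z, hz⟩ := exists_ne (0 : E)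
    have hbot : V = ⊥ := Submodule.finrank_eq_zero.1 (by simpa using hmax)
    refine ⟨z, hz, fun A hA => ?_⟩
    rw [hbot, Submodule.mem_bot] at hA
    simp [hA]
  | succ n ih =>
    intro E _ _ _ hn V hV hmax
    have : Nontrivial E := Module.nontrivial_of_finrank_pos (R := K) (by omega)
    -- In dimension two `V` is spanned by one nilpotent operator, and its kernel serves.
    rcases n.eq_zero_or_pos with rfl | hpos
    · obtain ⟨A, -, hA⟩ := finrank_eq_one_iff'.1 (hmax.trans (by simp : (0 + 1 + 1).choose 2 = 1))
      obtain ⟨z, hz, hAz⟩ : ∃ z : E, z ≠ 0 ∧ (A : Module.End K E) z = 0 := by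
        by_contra! h
        obtain ⟨k, hk⟩ := hV A A.2
        obtain ⟨v, hv⟩ := exists_ne (0 : E)
        have : ∀ m : ℕ, ((A : Module.End K E) ^ m) v ≠ 0 := by
          intro m
          induction m with
          | zero => simpa using hv
          | succ m ih => rw [pow_succ', Module.End.mul_apply]; exact h _ ih
        exact this k (by rw [hk]; rfl)
      refine ⟨z, hz, fun B hB => ?_⟩
      obtain ⟨c, hc⟩ := hA ⟨B, hB⟩
      have : B = c • (A : Module.End K E) := (congrArg Subtype.val hc).symm
      simp [this, hAz]
    obtain ⟨x, hx, hadapted⟩ := exists_adapted hV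
    obtain ⟨f, hfx⟩ := Module.Projective.exists_dual_eq_one K hx
    have hR : rankOneFunctionals V x = ⊥ := (Submodule.eq_bot_iff _).2 hadapted
    have hxV := notMem_map_apply hV hx
    have hlt := Submodule.finrank_lt (s := V.map (LinearMap.applyₗ x))
      fun h => hxV (h ▸ Submodule.mem_top)
    have hH := finrank_ker_of_apply_eq_one hn hfx
    have hVc := isNilpotent_of_mem_map_compress hV hfx
    have hc := finrank_le_choose (n + 1) hH hVc
    rw [finrank_eq_finrank_map_add hV hfx, hR, finrank_bot, Nat.choose_succ_succ (n + 1) 1,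
      Nat.choose_one_right] at hmax
    simp only [Nat.succ_eq_add_one, Nat.reduceAdd] at hmax
    have hc' : Module.finrank K ((annihilating V x).map (compress f x hfx))
        = (n + 1).choose 2 := by omega
    obtain ⟨y, hy, hVy⟩ := ih hH hVc hc'
    obtain ⟨g, hg⟩ := Module.Projective.exists_dual_eq_one K hy
    have hyR := (finrank_compress_eq_and_rankOne_mem hVc hH hc' hg hVy).2
    have hspan : ∀ v, ∃ M ∈ V, ∃ α : K, v = M x + α • x := by
      have hlt' : V.map (LinearMap.applyₗ x) < V.map (LinearMap.applyₗ x) ⊔ Submodule.span K {x} :=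
        lt_of_le_of_ne le_sup_left fun h => hxV <| h ▸
          Submodule.mem_sup_right (Submodule.mem_span_singleton_self x)
      have h1 := Submodule.finrank_lt_finrank_of_lt hlt'
      have h2 := Submodule.finrank_le (V.map (LinearMap.applyₗ x) ⊔ Submodule.span K {x})
      have htop := Submodule.eq_top_of_finrank_eq
        (S := V.map (LinearMap.applyₗ x) ⊔ Submodule.span K {x}) (by omega)
      intro v
      obtain ⟨_, ⟨M, hM, rfl⟩, w, hw, rfl⟩ := Submodule.mem_sup.1 (htop ▸ Submodule.mem_top : v ∈ _)
      obtain ⟨α, rfl⟩ := Submodule.mem_span_singleton.1 hw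
      exact ⟨M, hM, α, rfl⟩
    obtain ⟨t, ht⟩ := exists_forall_rankOne_mem (V := V) (x := x) (y := y) hadapted
      fun L hLx hLy => by
        obtain ⟨A, ⟨hA, hAx⟩, hAL⟩ := hyR (L ∘ₗ (LinearMap.ker f).subtype) hLy
        have hAx : A x = 0 := hAx
        refine exists_rankOne_mem_of_add_mem hV hspan (c := f ∘ₗ A) hLx hLy (by simp [hAx]) ?_
        have : L.smulRight (y : E) + (f ∘ₗ A).smulRight x = A := by
          ext v
          rw [apply_eq_of_apply_eq_zero hfx hAx v, hAL]
          simp [coe_kerProj, hLx, add_comm]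
        rw [this]
        exact hA
    refine ⟨(y : E) + t • x, fun h => hy ?_, apply_eq_zero_of_forall_rankOne_mem hV (x := x)
      (fun L hLx hLz => ht L hLx (by simpa [hLx] using hLz)) hspan (by omega)⟩
    have ht0 : t = 0 := by
      have := congrArg f h
      have hfy : f y = 0 := y.2
      simpa [hfy, hfx] using this
    simpa [ht0] using h

/-- The equality case of Gerstenhaber's theorem: a space of nilpotent operators of dimension
`n (n - 1) / 2` is strictly upper triangular in a suitable basis. -/
theorem exists_basis_strictly_triangular (n : ℕ) : ∀ {E : Type u} [AddCommGroup E]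
    [Module K E] [FiniteDimensional K E] (_ : Module.finrank K E = n)
    {V : Submodule K (Module.End K E)} (_ : ∀ A ∈ V, IsNilpotent A)
    (_ : Module.finrank K V = n.choose 2), ∃ β : Module.Basis (Fin n) K E,
      ∀ A ∈ V, ∀ j, A (β j) ∈ Submodule.span K (β '' Set.Iio j) := by
  induction n with
  | zero =>
    intro E _ _ _ hn V hV hmax
    exact ⟨Module.finBasisOfFinrankEq K E hn, fun A hA j => j.elim0⟩
  | succ n ih =>
    intro E _ _ _ hn V hV hmax
    obtain ⟨z, hz, hVz⟩ := exists_forall_apply_eq_zero n hn hV hmax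
    obtain ⟨f, hfz⟩ := Module.Projective.exists_dual_eq_one K hz
    obtain ⟨β, hβ⟩ := ih (finrank_ker_of_apply_eq_one hn hfz)
      (isNilpotent_of_mem_map_compress hV hfz)
      (finrank_compress_eq_and_rankOne_mem hV hn hmax hfz hVz).1
    refine ⟨Module.Basis.mkFinCons z β ?_ ?_, fun A hA j => ?_⟩
    · intro c w hw h
      have hw : f w = 0 := hw
      simpa [hw, hfz] using congrArg f h
    · intro v
      exact ⟨-f v, by simp [hfz]⟩
    rw [Module.Basis.coe_mkFinCons]
    have hAz := hVz A hA
    refine Fin.cases ?_ (fun j => ?_) j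
    · simp [hAz]
    · have h := hβ _ ⟨A, ⟨hA, hAz⟩, rfl⟩ j
      rw [Fin.cons_succ, apply_eq_of_apply_eq_zero hfz hAz]
      refine Submodule.add_mem _ (Submodule.smul_mem _ _
        (Submodule.subset_span ⟨0, Fin.succ_pos j, rfl⟩)) ?_
      have hm := Submodule.mem_map_of_mem (f := (LinearMap.ker f).subtype) h
      rw [Submodule.map_span] at hm
      rw [Function.comp_apply, kerProj_coe]
      refine Submodule.span_mono ?_ hm
      rintro _ ⟨_, ⟨i, hi, rfl⟩, rfl⟩
      exact ⟨i.succ, Fin.succ_lt_succ_iff.2 hi, rfl⟩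

end NilpotentSpace

/-! ### Spaces of local dimension one -/

open Topology Filter

namespace ElementaryOperators

variable {X Y : Type*} [AddCommGroup X] [Module ℂ X] [AddCommGroup Y] [Module ℂ Y]

/-- A space of linear maps whose values at each vector are proportional is spanned by a single map,
or else all its members take values in one common line. -/
theorem eq_smul_or_range_le_line {V : Submodule ℂ (X →ₗ[ℂ] Y)}
    (hV : ∀ S ∈ V, ∀ T ∈ V, ∀ ζ, T ζ ≠ 0 → ∃ c : ℂ, S ζ = c • T ζ) :
    (∃ T ∈ V, ∀ S ∈ V, ∃ c : ℂ, S = c • T) ∨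
      ∃ y : Y, y ≠ 0 ∧ ∀ T ∈ V, ∀ ζ, ∃ c : ℂ, T ζ = c • y := by
  have hker : ∀ S ∈ V, ∀ T ∈ V, ∀ ζ ζ', T ζ = 0 → T ζ' ≠ 0 → ∃ c : ℂ, S ζ = c • T ζ' := by
    intro S hS T hT ζ ζ' hζ hζ'
    obtain ⟨c, hc⟩ := hV S hS T hT ζ' hζ'
    obtain ⟨d, hd⟩ := hV S hS T hT (ζ + ζ') (by simpa [hζ] using hζ')
    rw [map_add, map_add, hζ, zero_add, hc] at hd
    exact ⟨d - c, by rw [sub_smul, ← hd, add_sub_cancel_right]⟩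
  by_cases hrank : ∃ T ∈ V, ∃ ζ₁ ζ₂, T ζ₁ ≠ 0 ∧ ∀ c : ℂ, T ζ₂ ≠ c • T ζ₁
  · left
    obtain ⟨T, hT, ζ₁, ζ₂, h₁, h₂⟩ := hrank
    refine ⟨T, hT, fun S hS => ?_⟩
    have hTS : ∀ ζ, T ζ = 0 → S ζ = 0 := by
      intro ζ hζ
      obtain ⟨c, hc⟩ := hker S hS T hT ζ ζ₁ hζ h₁
      obtain ⟨d, hd⟩ := hker S hS T hT ζ ζ₂ hζ (by simpa using h₂ 0)
      have hd0 : d = 0 := by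
        by_contra hd0
        refine h₂ (d⁻¹ * c) ?_
        rw [mul_smul, ← hc, hd, inv_smul_smul₀ hd0]
      rw [hd, hd0, zero_smul]
    obtain ⟨μ, hμ⟩ := hV S hS T hT ζ₁ h₁
    refine ⟨μ, LinearMap.ext fun ζ => ?_⟩
    rw [LinearMap.smul_apply]
    by_cases hζ : ∃ c : ℂ, T ζ = c • T ζ₁
    · obtain ⟨c, hc⟩ := hζ
      have := hTS (ζ - c • ζ₁) (by simp [hc])
      rw [map_sub, map_smul, sub_eq_zero] at this
      rw [this, hμ, hc, smul_comm]
    · push Not at hζ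
      obtain ⟨ν, hν⟩ := hV S hS T hT ζ (by simpa using hζ 0)
      obtain ⟨κ, hκ⟩ := hV S hS T hT (ζ + ζ₁) fun h => hζ (-1) (by
        rw [map_add] at h
        rw [neg_one_smul]
        exact eq_neg_of_add_eq_zero_left h)
      rw [map_add, map_add, hμ, hν] at hκ
      have h : (ν - κ) • T ζ = (κ - μ) • T ζ₁ := by
        rw [sub_smul, sub_smul, sub_eq_sub_iff_add_eq_add, hκ, smul_add, add_comm]
      have hνκ : ν = κ := by
        by_contra hne
        have hne := sub_ne_zero.2 hne
        exact hζ ((ν - κ)⁻¹ * (κ - μ)) (by rw [mul_smul, ← h, inv_smul_smul₀ hne])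
      have hκμ : κ = μ := by
        rw [hνκ, sub_self, zero_smul] at h
        simpa [h₁, sub_eq_zero] using h.symm
      rw [hν, hνκ, hκμ]
  · push Not at hrank
    by_cases hbot : V = ⊥
    · exact Or.inl ⟨0, V.zero_mem, fun S hS => ⟨0, by simpa [hbot] using hS⟩⟩
    obtain ⟨T, hT, hT0⟩ := Submodule.exists_mem_ne_zero_of_ne_bot hbot
    obtain ⟨ζ₁, h₁⟩ : ∃ ζ, T ζ ≠ 0 := by
      by_contra! h
      exact hT0 (LinearMap.ext h)
    refine Or.inr ⟨T ζ₁, h₁, fun S hS ζ => ?_⟩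
    by_cases hζ : T ζ = 0
    · exact hker S hS T hT ζ ζ₁ hζ h₁
    · obtain ⟨c, hc⟩ := hV S hS T hT ζ hζ
      obtain ⟨d, hd⟩ := hrank T hT ζ₁ ζ h₁
      exact ⟨c * d, by rw [hc, hd, mul_smul]⟩

theorem exists_eq_smul_of_finrank_evalAt_le_one {V : Submodule ℂ (X →ₗ[ℂ] Y)}
    [FiniteDimensional ℂ V] {ζ : X} (h : Module.finrank ℂ (evalAt V ζ) ≤ 1)
    {S T : X →ₗ[ℂ] Y} (hS : S ∈ V) (hT : T ∈ V) (hTζ : T ζ ≠ 0) : ∃ c : ℂ, S ζ = c • T ζ := by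
  have : FiniteDimensional ℂ (evalAt V ζ) := by unfold evalAt; infer_instance
  obtain ⟨v, hv⟩ := finrank_le_one_iff.1 h
  obtain ⟨c, hc⟩ := hv ⟨S ζ, S, hS, rfl⟩
  obtain ⟨d, hd⟩ := hv ⟨T ζ, T, hT, rfl⟩
  have hc : c • (v : Y) = S ζ := congrArg Subtype.val hc
  have hd : d • (v : Y) = T ζ := congrArg Subtype.val hd
  have hd0 : d ≠ 0 := by rintro rfl; simp at hd; exact hTζ hd.symm
  exact ⟨c * d⁻¹, by rw [← hc, ← hd, smul_smul, inv_mul_cancel_right₀ hd0]⟩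

/-! ### Vectors that separate the left coefficients -/

variable {n : ℕ}

theorem evalAt_spaceL (a : Fin n → Module.End ℂ X) (ζ : X) :
    evalAt (spaceL a) ζ = Submodule.span ℂ (Set.range fun i => a i ζ) := by
  rw [evalAt, spaceL, Submodule.map_span, ← Set.range_comp]
  rfl

theorem exists_linearIndependent_apply {a : Fin n → Module.End ℂ X} (hL : lDim (spaceL a) = n) :
    ∃ ζ, LinearIndependent ℂ fun i => a i ζ := by
  have : FiniteDimensional ℂ (spaceL a) := FiniteDimensional.span_of_finite ℂ (Set.finite_range a)
  obtain ⟨ζ, hζ⟩ := (isGreatest_lDim (spaceL a)).1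
  refine ⟨ζ, linearIndependent_iff_card_eq_finrank_span.2 ?_⟩
  rw [Set.finrank, ← evalAt_spaceL, Fintype.card_fin]
  exact (hζ.trans hL).symm

/-- Independence of the vectors `a i ζ₀` is generic along every line in the direction `ζ₀`: after
composition with a left inverse `p` it fails only if `-t` is an eigenvalue of the matrix of the
`p (a i ζ)`. -/
theorem eventually_linearIndependent_apply_add {a : Fin n → Module.End ℂ X} {ζ₀ : X}
    (h₀ : LinearIndependent ℂ fun i => a i ζ₀) (ζ : X) :
    ∀ᶠ t in 𝓝[≠] (0 : ℂ), LinearIndependent ℂ fun i => a i (ζ + t • ζ₀) := by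
  obtain ⟨p, hp⟩ := (Fintype.linearCombination ℂ fun i => a i ζ₀).exists_leftInverse_of_injective
    (LinearMap.ker_eq_bot.2 (linearIndependent_iff_injective_fintypeLinearCombination.1 h₀))
  set R : Module.End ℂ (Fin n → ℂ) := p ∘ₗ Fintype.linearCombination ℂ fun i => a i ζ with hR
  have hfin : {t : ℂ | -t ∈ spectrum ℂ R}.Finite :=
    (Module.End.finite_spectrum R).preimage neg_injective.injOn
  filter_upwards [nhdsNE_le_cofinite 0 hfin.compl_mem_cofinite] with t ht
  have ht : IsUnit (algebraMap ℂ (Module.End ℂ (Fin n → ℂ)) (-t) - R) := by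
    simpa [spectrum.mem_iff] using ht
  have hinj := ((Module.End.isUnit_iff _).1 ht).1
  rw [linearIndependent_iff_injective_fintypeLinearCombination, injective_iff_map_eq_zero]
  intro c hc
  refine (injective_iff_map_eq_zero _).1 hinj c ?_
  have hpc : p (Fintype.linearCombination ℂ (fun i => a i ζ₀) c) = c := LinearMap.congr_fun hp c
  have hRc : R c = p (Fintype.linearCombination ℂ (fun i => a i ζ) c) := rfl
  have hsum : Fintype.linearCombination ℂ (fun i => a i (ζ + t • ζ₀)) c
      = Fintype.linearCombination ℂ (fun i => a i ζ) c
        + t • Fintype.linearCombination ℂ (fun i => a i ζ₀) c := by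
    simp only [Fintype.linearCombination_apply, map_add, map_smul, smul_add,
      Finset.sum_add_distrib, Finset.smul_sum, smul_comm t]
  rw [hsum] at hc
  have := congrArg p hc
  rw [map_add, map_smul, hpc, ← hRc, map_zero] at this
  rw [LinearMap.sub_apply, Module.algebraMap_end_apply, neg_smul, sub_eq_zero]
  exact (eq_neg_of_add_eq_zero_left this).symm

/-! ### The coefficient matrices -/

theorem mul_mem_spaceV (a b : Fin n → Module.End ℂ X) (i j : Fin n) : b i * a j ∈ spaceV a b :=
  Submodule.subset_span ⟨(i, j), rfl⟩

instance finiteDimensional_spaceV (a b : Fin n → Module.End ℂ X) :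
    FiniteDimensional ℂ (spaceV a b) :=
  FiniteDimensional.span_of_finite ℂ (Set.finite_range _)

/-- The matrix `(g (b i * a j))` attached to a functional `g` on `V(φ)`. -/
def coeffMatrix (a b : Fin n → Module.End ℂ X) :
    Module.Dual ℂ (spaceV a b) →ₗ[ℂ] Matrix (Fin n) (Fin n) ℂ where
  toFun g := Matrix.of fun i j => g ⟨b i * a j, mul_mem_spaceV a b i j⟩
  map_add' g h := by ext; simp
  map_smul' c g := by ext; simp

theorem coeffMatrix_apply (a b : Fin n → Module.End ℂ X) (g : Module.Dual ℂ (spaceV a b))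
    (i j : Fin n) : coeffMatrix a b g i j = g ⟨b i * a j, mul_mem_spaceV a b i j⟩ := rfl

theorem coeffMatrix_injective (a b : Fin n → Module.End ℂ X) :
    Function.Injective (coeffMatrix a b) := by
  rw [injective_iff_map_eq_zero]
  intro g hg
  ext ⟨T, hT⟩
  refine Submodule.span_induction (p := fun T hT => g ⟨T, hT⟩ = 0) ?_ ?_ ?_ ?_ hT
  · rintro _ ⟨⟨i, j⟩, rfl⟩
    exact congrFun (congrFun hg i) j
  · exact map_zero g
  · intro S T hS hT h h'
    have := map_add g ⟨S, hS⟩ ⟨T, hT⟩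
    rwa [h, h', add_zero] at this
  · intro c T hT h
    have := map_smul g c ⟨T, hT⟩
    rwa [h, smul_zero] at this

/-- If the functional `g` is evaluation at a vector `ζ` for which the `a i ζ` are independent, and
`x y = ζ`, then `coeffMatrix a b g` is the matrix of `φ x` on `L(φ) ζ` in the basis `a i ζ`, hence
nilpotent. -/
theorem isNilpotent_coeffMatrix_of_eval {A : NonUnitalSubalgebra ℂ (Module.End ℂ X)}
    (hA : IsDenseAlgebra A) {a b : Fin n → Module.End ℂ X} (hnil : LocallyNilpotent A a b)
    {ζ : X} (hζ : LinearIndependent ℂ fun i => a i ζ) {y : X} (hy : y ≠ 0)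
    {g : Module.Dual ℂ (spaceV a b)}
    (hg : ∀ T : spaceV a b, (T : Module.End ℂ X) ζ = g T • y) :
    IsNilpotent (coeffMatrix a b g) := by
  obtain ⟨x, hxA, hx⟩ := hA 1 (fun _ => y) (fun _ => ζ) (by simpa using hy)
  have hx : x y = ζ := hx 0
  obtain ⟨hW, k, hk⟩ := hnil ζ ⟨x, hxA⟩ (by
    rintro _ ⟨_, ⟨T, hT, rfl⟩, rfl⟩
    refine Submodule.mem_span_singleton.2 ⟨g ⟨T, hT⟩, ?_⟩
    have := hg ⟨T, hT⟩
    simp only [LinearMap.applyₗ_apply_apply]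
    rw [this, map_smul, hx])
  set Φ := elementaryOperator A a b ⟨x, hxA⟩ with hΦ
  set s := Fintype.linearCombination ℂ fun i => a i ζ with hs
  set F := Matrix.toLin' (coeffMatrix a b g) with hF
  have hsj : ∀ j, s (Pi.single j 1) = a j ζ := by
    intro j; simp [hs]
  have hcomm : Φ ∘ₗ s = s ∘ₗ F := by
    refine LinearMap.pi_ext' fun j => LinearMap.ext_ring ?_
    have h1 : Φ (a j ζ) = ∑ i, coeffMatrix a b g i j • a i ζ := by
      simp only [hΦ, elementaryOperator, LinearMap.coe_mk, AddHom.coe_mk, LinearMap.sum_apply,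
        Module.End.mul_apply]
      refine Finset.sum_congr rfl fun i _ => ?_
      have := hg ⟨b i * a j, mul_mem_spaceV a b i j⟩
      rw [Module.End.mul_apply] at this
      rw [this, map_smul, hx, map_smul, coeffMatrix_apply]
    simp only [LinearMap.comp_apply, LinearMap.single_apply]
    rw [hsj, h1, hF, Matrix.toLin'_apply, Matrix.mulVec_single_one, hs,
      Fintype.linearCombination_apply]
    rfl
  have hpow : ∀ (m : ℕ) (c), (Φ ^ m) (s c) = s ((F ^ m) c) := by
    intro m
    induction m with
    | zero => simp
    | succ m ih =>
      intro c
      rw [pow_succ, Module.End.mul_apply, show Φ (s c) = s (F c) from LinearMap.congr_fun hcomm c,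
        ih, pow_succ, Module.End.mul_apply]
  have hmem : ∀ c, s c ∈ evalAt (spaceL a) ζ := by
    intro c
    rw [evalAt_spaceL, ← Fintype.range_linearCombination]
    exact ⟨c, rfl⟩
  rw [← Matrix.isNilpotent_toLin'_iff]
  refine ⟨k, LinearMap.ext fun c =>
    linearIndependent_iff_injective_fintypeLinearCombination.1 hζ ?_⟩
  have h := congrArg Subtype.val (LinearMap.congr_fun hk ⟨s c, hmem c⟩)
  rw [Module.End.pow_restrict] at h
  rw [← hs, ← hpow]
  simpa using h

theorem pow_eq_zero_of_isNilpotent {M : Matrix (Fin n) (Fin n) ℂ} (hM : IsNilpotent M) :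
    M ^ n = 0 := by
  have h := (LinearMap.isNilpotent_iff_charpoly _).1 (Matrix.isNilpotent_toLin'_iff M |>.2 hM)
  have h' := LinearMap.aeval_self_charpoly (Matrix.toLin' M)
  rw [h, Module.finrank_fin_fun, map_pow, Polynomial.aeval_X, ← Matrix.toLin'_pow] at h'
  exact Matrix.toLin'.map_eq_zero_iff.1 h'

/-- Nilpotency of `M + t • M₀` for small nonzero `t` passes to the limit `t → 0`, as it amounts to
the closed condition that the `n`-th power vanish. -/
theorem isNilpotent_of_eventually {M M₀ : Matrix (Fin n) (Fin n) ℂ}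
    (h : ∀ᶠ t in 𝓝[≠] (0 : ℂ), IsNilpotent (M + t • M₀)) : IsNilpotent M := by
  have hcont : Continuous fun t : ℂ => (M + t • M₀) ^ n := by fun_prop
  have h1 : Tendsto (fun t : ℂ => (M + t • M₀) ^ n) (𝓝[≠] 0) (𝓝 ((M + (0 : ℂ) • M₀) ^ n)) :=
    (hcont.tendsto 0).mono_left nhdsWithin_le_nhds
  have h2 : Tendsto (fun t : ℂ => (M + t • M₀) ^ n) (𝓝[≠] 0) (𝓝 0) :=
    tendsto_const_nhds.congr' (h.mono fun t ht => (pow_eq_zero_of_isNilpotent ht).symm)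
  exact ⟨n, by simpa using tendsto_nhds_unique h1 h2⟩

/-- Every coefficient matrix is nilpotent. If `V(φ)` is spanned by one `T`, each nonzero functional
is, up to scaling, evaluation at some `ζ` with `T ζ ≠ 0` and independent `a i ζ`. If all ranges lie
in a line, the functionals are the evaluations at arbitrary vectors, which are limits of such `ζ`
along lines. -/
theorem isNilpotent_coeffMatrix {A : NonUnitalSubalgebra ℂ (Module.End ℂ X)}
    (hA : IsDenseAlgebra A) {a b : Fin n → Module.End ℂ X} (hL : lDim (spaceL a) = n)
    (hV : lDim (spaceV a b) = 1) (hnil : LocallyNilpotent A a b)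
    (g : Module.Dual ℂ (spaceV a b)) : IsNilpotent (coeffMatrix a b g) := by
  obtain ⟨ζ₀, h₀⟩ := exists_linearIndependent_apply hL
  have hmax := isGreatest_lDim (spaceV a b)
  rw [hV] at hmax
  rcases eq_smul_or_range_le_line (V := spaceV a b) fun S hS T hT ζ hζ =>
    exists_eq_smul_of_finrank_evalAt_le_one (hmax.2 ⟨ζ, rfl⟩) hS hT hζ with
    ⟨T, hT, hspan⟩ | ⟨y, hy, hline⟩
  · by_cases hgT : g ⟨T, hT⟩ = 0
    · have : g = 0 := by
        ext ⟨S, hS⟩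
        obtain ⟨c, rfl⟩ := hspan S hS
        exact (map_smul g c ⟨T, hT⟩).trans (by rw [hgT, smul_zero])
      simp [this]
    have hT0 : T ≠ 0 := fun h => hgT (by
      rw [show (⟨T, hT⟩ : spaceV a b) = 0 from Subtype.ext h, map_zero])
    obtain ⟨ζ, hζ, hTζ⟩ : ∃ ζ, (LinearIndependent ℂ fun i => a i ζ) ∧ T ζ ≠ 0 := by
      by_cases hT₀ : T ζ₀ = 0
      · obtain ⟨ζ₁, h₁⟩ : ∃ ζ, T ζ ≠ 0 := by
          by_contra! h
          exact hT0 (LinearMap.ext h)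
        obtain ⟨t, ht⟩ := (eventually_linearIndependent_apply_add h₀ ζ₁).exists
        exact ⟨_, ht, by simpa [hT₀] using h₁⟩
      · exact ⟨ζ₀, h₀, hT₀⟩
    refine isNilpotent_coeffMatrix_of_eval hA hnil hζ (y := (g ⟨T, hT⟩)⁻¹ • T ζ)
      (smul_ne_zero (inv_ne_zero hgT) hTζ) ?_
    rintro ⟨S, hS⟩
    obtain ⟨c, rfl⟩ := hspan S hS
    rw [show g ⟨c • T, hS⟩ = c • g ⟨T, hT⟩ from map_smul g c ⟨T, hT⟩]
    rw [smul_eq_mul, mul_smul, smul_inv_smul₀ hgT]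
    rfl
  · obtain ⟨h, hhy⟩ := Module.Projective.exists_dual_eq_one ℂ hy
    let ev : X →ₗ[ℂ] Module.Dual ℂ (spaceV a b) :=
      { toFun := fun ζ => h ∘ₗ LinearMap.applyₗ ζ ∘ₗ (spaceV a b).subtype
        map_add' := fun ζ ζ' => by ext; simp
        map_smul' := fun c ζ => by ext; simp }
    have hev : ∀ (ζ : X) (T : spaceV a b), (T : Module.End ℂ X) ζ = ev ζ T • y := by
      intro ζ T
      obtain ⟨c, hc⟩ := hline T T.2 ζ
      have : ev ζ T = h ((T : Module.End ℂ X) ζ) := rfl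
      rw [this, hc]
      simp [hhy]
    -- An element of the bidual that annihilates all evaluations is a `T` with
    -- `T ζ = 0` for all `ζ`.
    have hsurj : LinearMap.range ev = ⊤ := by
      by_contra htop
      obtain ⟨ψ, hψ0, hψ⟩ := Submodule.exists_le_ker_of_lt_top _ (lt_top_iff_ne_top.2 htop)
      obtain ⟨T, rfl⟩ := (Module.evalEquiv ℂ (spaceV a b)).surjective ψ
      have hT : T = 0 := by
        refine Subtype.ext (LinearMap.ext fun ζ => ?_)
        have : ev ζ T = 0 := hψ ⟨ζ, rfl⟩
        rw [hev ζ T, this, zero_smul]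
        rfl
      exact hψ0 (by simp [hT])
    obtain ⟨ζ, rfl⟩ : g ∈ LinearMap.range ev := hsurj ▸ Submodule.mem_top
    refine isNilpotent_of_eventually (M₀ := coeffMatrix a b (ev ζ₀)) ?_
    filter_upwards [eventually_linearIndependent_apply_add h₀ ζ] with t ht
    rw [← map_smul, ← map_add, ← map_smul, ← map_add]
    exact isNilpotent_coeffMatrix_of_eval hA hnil ht hy (hev _)

/-! ### Change of basis -/

theorem sum_smul_mul_sum_smul_eq_zero {a b : Fin n → Module.End ℂ X}
    {r s : Fin n → ℂ} (h : ∀ g, ∑ l, ∑ k, r l * coeffMatrix a b g l k * s k = 0) :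
    (∑ l, r l • b l) * (∑ k, s k • a k) = 0 := by
  have e : (∑ l, r l • b l) * (∑ k, s k • a k)
      = ((∑ l, ∑ k, (r l * s k) • (⟨b l * a k, mul_mem_spaceV a b l k⟩ : spaceV a b) :
        spaceV a b) : Module.End ℂ X) := by
    simp [Finset.sum_mul_sum, smul_smul, mul_comm]
  rw [e, ZeroMemClass.coe_eq_zero, ← Module.forall_dual_apply_eq_zero_iff ℂ]
  intro g
  rw [← h g]
  simp only [map_sum, map_smul, coeffMatrix_apply, smul_eq_mul]
  refine Finset.sum_congr rfl fun l _ => Finset.sum_congr rfl fun k _ => by ring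

theorem elementaryOperator_changeBasis (A : NonUnitalSubalgebra ℂ (Module.End ℂ X))
    (a b : Fin n → Module.End ℂ X) (β : Module.Basis (Fin n) ℂ (Fin n → ℂ)) :
    elementaryOperator A a b = elementaryOperator A (fun j => ∑ k, β j k • a k)
      (fun i => ∑ l, β.repr (Pi.single l 1) i • b l) := by
  ext1 x
  simp only [elementaryOperator, LinearMap.coe_mk, AddHom.coe_mk]
  have hδ : ∀ k l, ∑ i, β i k * β.repr (Pi.single l 1) i = if k = l then 1 else 0 := by
    intro k l
    have := congrFun (β.sum_repr (Pi.single l 1)) k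
    simpa [Pi.single_apply, mul_comm] using this
  have : ∀ i, (∑ k, β i k • a k) * (x : Module.End ℂ X) * (∑ l, β.repr (Pi.single l 1) i • b l)
      = ∑ k, ∑ l, (β i k * β.repr (Pi.single l 1) i) • (a k * (x : Module.End ℂ X) * b l) := by
    intro i
    simp only [Finset.sum_mul, Finset.mul_sum, smul_mul_assoc, mul_smul_comm,
      Finset.smul_sum, smul_smul]
    rw [Finset.sum_comm]
    simp only [mul_comm]
  simp only [this]
  rw [Finset.sum_comm]
  refine Finset.sum_congr rfl fun k _ => ?_
  rw [Finset.sum_comm]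
  simp [← Finset.sum_smul, hδ]

end ElementaryOperators

open ElementaryOperators in
theorem proposition3p4 {X : Type*} [AddCommGroup X] [Module ℂ X]
    (A : NonUnitalSubalgebra ℂ (Module.End ℂ X)) (hA : IsDenseAlgebra A)
    (n : ℕ) (a b : Fin n → Module.End ℂ X) (φ : A →ₗ[ℂ] Module.End ℂ X)
    (hφ : φ = elementaryOperator A a b) (hlen : ElementaryOperators.length φ = n)
    (hL : lDim (spaceL a) = n) (hV : lDim (spaceV a b) = 1)
    (hnil : LocallyNilpotent A a b) :
    Module.finrank ℂ (spaceV a b) ≤ n * (n - 1) / 2 ∧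
      (Module.finrank ℂ (spaceV a b) = n * (n - 1) / 2 →
        ∃ u v : Fin n → Module.End ℂ X, φ = elementaryOperator A u v ∧
          ∀ i j : Fin n, j ≤ i → v i * u j = 0) := by
  set N := LinearMap.range
    ((Matrix.toLin' : Matrix (Fin n) (Fin n) ℂ ≃ₗ[ℂ] _).toLinearMap ∘ₗ coeffMatrix a b) with hN
  have hNV : Module.finrank ℂ N = Module.finrank ℂ (spaceV a b) := by
    rw [hN, LinearMap.finrank_range_of_inj, Subspace.dual_finrank_eq]
    exact Matrix.toLin'.injective.comp (coeffMatrix_injective a b)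
  have hNnil : ∀ T ∈ N, IsNilpotent T := by
    rintro _ ⟨g, rfl⟩
    exact (Matrix.isNilpotent_toLin'_iff _).2 (isNilpotent_coeffMatrix hA hL hV hnil g)
  have hdim : Module.finrank ℂ (Fin n → ℂ) = n := Module.finrank_fin_fun ℂ
  rw [← Nat.choose_two_right, ← hNV]
  refine ⟨NilpotentSpace.finrank_le_choose n hdim hNnil, fun hmax => ?_⟩
  obtain ⟨β, hβ⟩ := NilpotentSpace.exists_basis_strictly_triangular n hdim hNnil hmax
  refine ⟨_, _, hφ.trans (elementaryOperator_changeBasis A a b β), fun i j hij => ?_⟩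
  refine sum_smul_mul_sum_smul_eq_zero fun g => ?_
  have h0 : β.repr (Matrix.toLin' (coeffMatrix a b g) (β j)) i = 0 := by
    by_contra hne
    exact not_lt_of_ge hij (β.mem_span_image.1 (hβ _ ⟨g, rfl⟩ j) (Finsupp.mem_support_iff.2 hne))
  rw [← h0, pi_eq_sum_univ' (Matrix.toLin' (coeffMatrix a b g) (β j))]
  simp only [map_sum, map_smul, Finsupp.coe_finsetSum, Finset.sum_apply, Finsupp.smul_apply,
    Matrix.toLin'_apply, Matrix.mulVec, dotProduct, smul_eq_mul, Finset.sum_mul]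
  refine Finset.sum_congr rfl fun l _ => Finset.sum_congr rfl fun k _ => ?_
  ring
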